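/- All groups and graphs are finite, and graphs are simple. For a graph $\Gamma$ with vertex set $V\Gamma$, a group $G\le\mathrm{Aut}(\Gamma)$ and $v\in V\Gamma$, let $G_v$ be the stabiliser of $v$ in $G$ and let $G_v^{\Gamma(v)}$ be the permutation group that $G_v$ induces on the neighbourhood $\Gamma(v)$. For a permutation group $L$, the pair $(\Gamma,G)$ is called locally-$L$ if $\Gamma$ is connected, $G$ is transitive on $V\Gamma$, and $G_v^{\Gamma(v)}$ is permutation isomorphic to $L$ for every $v\in V\Gamma$. We say that $L$ has exponential graph growth if there are locally-$L$ pairs $(\Gamma_n,G_n)$, $n\in\mathbb N$, with $|V\Gamma_n|\to\infty$, and a constant $c>1$, such that $|(G_n)_v|\ge c^{|V\Gamma_n|}$ for all $n\in\mathbb N$ and all $v\in V\Gamma_n$. Theorem. Let $L$ be a transitive permutation group on a finite set $\Omega$ and let $B$ be a nontrivial block of $L$ (that is, a block with $1<|B|<|\Omega|$) such that the pointwise stabiliser $L_{(\Omega\setminus B)}$ of $\Omega\setminus B$ in $L$ is nontrivial. Then $L$ has exponential graph growth. Moreover, with $k=|B|$, there are locally-$L$ pairs $(\Lambda_n,H_n)$,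 $n\in\mathbb N$, with $|V\Lambda_n|\to\infty$ and $$|(H_n)_v|\ \ge\ |L_{(\Omega\setminus B)}|^{\,|V\Lambda_n|/k-1}\qquad\text{for all } n\in\mathbb N \text{ and all } v\in V\Lambda_n.$$ -/

import Mathlib

namespace GraphGrowth

/-- Permutation groups `L` on `Ω` and `M` on `Δ` are permutation isomorphic if some bijection
`e : Ω ≃ Δ` carries `L` onto `M`, that is, `M = {e ∘ l ∘ e⁻¹ | l ∈ L}`. -/
def PermIsomorphic {Ω Δ : Type*} (L : Subgroup (Equiv.Perm Ω)) (M : Subgroup (Equiv.Perm Δ)) :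
    Prop :=
  ∃ e : Ω ≃ Δ, L.map e.permCongrHom.toMonoidHom = M

/-- The local action of `G ≤ Aut(Γ)` at `v`: the group of all permutations of the neighbourhood
of `v` that are induced by elements of the vertex-stabiliser `G_v`. -/
def localAction {V : Type*} {Γ : SimpleGraph V} (G : Subgroup (Γ ≃g Γ)) (v : V) :
    Subgroup (Equiv.Perm (Γ.neighborSet v)) where
  carrier := {σ | ∃ g ∈ G, g v = v ∧ ∀ w : Γ.neighborSet v, ((σ w : Γ.neighborSet v) : V) = g w}
  one_mem' := ⟨1, G.one_mem, rfl, fun _ => rfl⟩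
  mul_mem' := by
    rintro σ τ ⟨g, hg, hgv, hσ⟩ ⟨h, hh, hhv, hτ⟩
    refine ⟨g * h, G.mul_mem hg hh, ?_, fun w => ?_⟩
    · rw [RelIso.mul_apply, hhv, hgv]
    · rw [Equiv.Perm.mul_apply, hσ, hτ, RelIso.mul_apply]
  inv_mem' := by
    rintro σ ⟨g, hg, hgv, hσ⟩
    refine ⟨g⁻¹, G.inv_mem hg, ?_, fun w => ?_⟩
    · apply g.injective
      rw [RelIso.apply_inv_self, hgv]
    · apply g.injective
      rw [RelIso.apply_inv_self, ← hσ]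
      simp

/-- `(Γ, G)` is a locally-`L` pair: `Γ` is a finite connected (simple) graph, `G ≤ Aut(Γ)` is
transitive on the vertices, and the local action of `G` at each vertex is permutation isomorphic
to `L`. -/
structure IsLocallyPair {Ω V : Type*} (L : Subgroup (Equiv.Perm Ω)) (Γ : SimpleGraph V)
    (G : Subgroup (Γ ≃g Γ)) : Prop where
  finite : Finite V
  connected : Γ.Connected
  vertexTransitive : MulAction.IsPretransitive G V
  local_iso : ∀ v : V, PermIsomorphic (localAction G v) L

/-- `L` has exponential graph growth: there are locally-`L` pairs `(Γ_n, G_n)` with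
`|VΓ_n| → ∞` and a constant `c > 1` such that `|(G_n)_v| ≥ c ^ |VΓ_n|` for all `n` and `v`.
(A finite graph is isomorphic to one whose vertex type lives in `Type`.) -/
def HasExponentialGraphGrowth {Ω : Type*} (L : Subgroup (Equiv.Perm Ω)) : Prop :=
  ∃ (V : ℕ → Type) (Γ : (n : ℕ) → SimpleGraph (V n)) (G : (n : ℕ) → Subgroup (Γ n ≃g Γ n)),
    (∀ n, IsLocallyPair L (Γ n) (G n)) ∧
    Filter.Tendsto (fun n => Nat.card (V n)) Filter.atTop Filter.atTop ∧
    ∃ c : ℝ, 1 < c ∧ ∀ (n : ℕ) (v : V n),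
      c ^ Nat.card (V n) ≤ (Nat.card (MulAction.stabilizer (G n) v) : ℝ)

end GraphGrowth

namespace GraphGrowth

open Finset

/-! Let `J` be the set of translates of `B`. Take a cover of the complete bipartite graph on `J` and
`J` with voltages in an abelian group `X`, and replace each of its vertices over `j` by the points
of the block `j`. Every vertex then has exactly one neighbour labelled by each point of `Ω`. Let the
group consist of all automorphisms that act on the labels of each neighbourhood as an element of
`L`.

The local action is all of `L`, and the group is vertex-transitive, provided that independent
permutations of the two sides and the exchange of sides lift to the cover;
`exists_isHomogeneousVoltage` supplies such connected covers with `X` arbitrarily large.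

The stabilisers are large because a neighbourhood meets just one fibre over each block in each part
it meets. Conjugates of the fixer of the complement of `B` may therefore act independently on all
fibres (`blowupFiberwise_mem`), while the local action stays in `L`. There are |V|/k fibres, and
only the one through `v` has to be left alone (`pow_le_card_stabilizer_blowupGroup`). -/

/-! ### Homogeneous voltages from zero-sum matrices over `ZMod q`. -/

/-- The `R`-valued matrices all of whose row and column sums vanish. -/
def zeroSum (J R : Type*) [Fintype J] [CommRing R] : AddSubgroup (J → J → R) where
  carrier := {f | (∀ a, ∑ b, f a b = 0) ∧ ∀ b, ∑ a, f a b = 0}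
  zero_mem' := by simp
  add_mem' := by
    rintro f g ⟨hf, hf'⟩ ⟨hg, hg'⟩
    simp [sum_add_distrib, hf, hf', hg, hg']
  neg_mem' := by
    rintro f ⟨hf, hf'⟩
    simp [hf, hf']

/-- The voltage assignments on the complete bipartite graph with parts `J` and `J` whose derived
cover is connected and to which all automorphisms of the complete bipartite graph lift. -/
structure IsHomogeneousVoltage {J X : Type*} [AddCommGroup X] (s : J → J → X) : Prop where
  lift_swap : ∃ τ : X ≃+ X, ∀ a b, τ (s a b) = -s b a
  lift_perm : ∀ σ σ' : Equiv.Perm J, ∃ ρ : X ≃+ X, ∀ a b, ρ (s a b) = s (σ a) (σ' b)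
  generates : AddSubgroup.closure
    {x | ∃ a a' b b', x = s a b - s a' b + s a' b' - s a b'} = ⊤

section Voltage

variable {J R : Type*} [Fintype J] [DecidableEq J] [CommRing R]

/-- The standard basis vector at `a`, shifted by the constant `t`. -/
def shiftedBasis (t : R) (a c : J) : R := (if c = a then 1 else 0) + t

theorem sum_shiftedBasis {t : R} (ht : 1 + Fintype.card J * t = 0) (a : J) :
    ∑ c, shiftedBasis t a c = 0 := by
  simpa [shiftedBasis, sum_add_distrib] using ht

omit [Fintype J] in
theorem shiftedBasis_symm_apply (t : R) (σ : Equiv.Perm J) (a c : J) :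
    shiftedBasis t a (σ.symm c) = shiftedBasis t (σ a) c := by
  simp [shiftedBasis, Equiv.symm_apply_eq]

/-- The tensor product of two shifted basis vectors, as a matrix with vanishing row and column
sums. -/
def tensorVoltage {t : R} (ht : 1 + Fintype.card J * t = 0) (a b : J) : zeroSum J R :=
  ⟨fun c d => shiftedBasis t a c * shiftedBasis t b d, fun c => by
    simp [← mul_sum, sum_shiftedBasis ht], fun d => by
    simp [← sum_mul, sum_shiftedBasis ht]⟩

/-- The shift by `t` puts the voltages into `zeroSum` but cancels in alternating sums. -/
theorem tensorVoltage_alternating {t : R} (ht : 1 + Fintype.card J * t = 0) (a a' b b' c d : J) :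
    (tensorVoltage ht a b - tensorVoltage ht a' b + tensorVoltage ht a' b'
      - tensorVoltage ht a b' : zeroSum J R).1 c d =
      ((if c = a then 1 else 0) - if c = a' then 1 else 0) *
      ((if d = b then 1 else 0) - if d = b' then 1 else 0) := by
  simp only [tensorVoltage, AddSubgroup.coe_sub, AddSubgroup.coe_add, Pi.sub_apply, Pi.add_apply,
    shiftedBasis]
  ring

/-- Expand in elementary matrices: the correction terms at `a'` and `b'` carry whole row or column
sums of `f`, so they vanish. -/
theorem eq_sum_alternating {t : R} (ht : 1 + Fintype.card J * t = 0) (f : zeroSum J R)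
    (a' b' c d : J) :
    f.1 c d = ∑ a, ∑ b, f.1 a b * (tensorVoltage ht a b - tensorVoltage ht a' b
      + tensorVoltage ht a' b' - tensorVoltage ht a b' : zeroSum J R).1 c d := by
  obtain ⟨f, hf, hf'⟩ := f
  simp only [tensorVoltage_alternating]
  have h (a : J) : ∑ b, f a b * (((if c = a then 1 else 0) - if c = a' then 1 else 0) *
      ((if d = b then 1 else 0) - if d = b' then 1 else 0)) =
      f a d * ((if c = a then 1 else 0) - if c = a' then 1 else 0) := by
    calc _ = ((if c = a then 1 else 0) - if c = a' then 1 else 0) *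
        ∑ b, (f a b * (if d = b then 1 else 0) - f a b * if d = b' then 1 else 0) := by
          rw [mul_sum]; exact sum_congr rfl fun b _ => by ring
      _ = _ := by
          rw [sum_sub_distrib, ← sum_mul, hf]
          simp [mul_comm]
  rw [sum_congr rfl fun a _ => h a]
  simp only [mul_sub, sum_sub_distrib, ← sum_mul, hf']
  simp

/-- Permuting rows and columns of a matrix with vanishing row and column sums. -/
def zeroSumReindex (σ σ' : Equiv.Perm J) : zeroSum J R ≃+ zeroSum J R where
  toFun f := ⟨fun c d => f.1 (σ.symm c) (σ'.symm d),
    fun c => (Equiv.sum_comp σ'.symm (f.1 (σ.symm c))).trans (f.2.1 _),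
    fun d => (Equiv.sum_comp σ.symm fun c => f.1 c (σ'.symm d)).trans (f.2.2 _)⟩
  invFun f := ⟨fun c d => f.1 (σ c) (σ' d),
    fun c => (Equiv.sum_comp σ' (f.1 (σ c))).trans (f.2.1 _),
    fun d => (Equiv.sum_comp σ fun c => f.1 c (σ' d)).trans (f.2.2 _)⟩
  left_inv f := by simp
  right_inv f := by simp
  map_add' f g := rfl

/-- The negative of the transpose of a matrix with vanishing row and column sums. -/
def zeroSumNegTranspose : zeroSum J R ≃+ zeroSum J R where
  toFun f := ⟨fun c d => -f.1 d c, fun c => by simp [f.2.2 c], fun d => by simp [f.2.1 d]⟩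
  invFun f := ⟨fun c d => -f.1 d c, fun c => by simp [f.2.2 c], fun d => by simp [f.2.1 d]⟩
  left_inv f := by simp
  right_inv f := by simp
  map_add' f g := by
    ext c d
    exact neg_add _ _

theorem isHomogeneousVoltage_tensorVoltage {q : ℕ} [NeZero q] [Nonempty J] {t : ZMod q}
    (ht : 1 + Fintype.card J * t = 0) : IsHomogeneousVoltage (tensorVoltage (J := J) ht) where
  lift_swap := ⟨zeroSumNegTranspose, fun a b => by
    ext c d
    simp [zeroSumNegTranspose, tensorVoltage, mul_comm]⟩
  lift_perm σ σ' := ⟨zeroSumReindex σ σ', fun a b => by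
    ext c d
    simp [zeroSumReindex, tensorVoltage, shiftedBasis_symm_apply]⟩
  generates := by
    refine (AddSubgroup.eq_top_iff' _).2 fun f => ?_
    obtain ⟨j⟩ := ‹Nonempty J›
    -- Over `ZMod q` every scalar is a natural multiple, so the additive closure suffices.
    have hf : f = ∑ a, ∑ b, (f.1 a b).val • (tensorVoltage ht a b - tensorVoltage ht j b
        + tensorVoltage ht j j - tensorVoltage ht a j) := by
      ext c d
      rw [eq_sum_alternating ht f j j c d]
      simp only [AddSubgroup.val_finsetSum, Finset.sum_apply, AddSubgroup.coe_nsmul, Pi.smul_apply,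
        nsmul_eq_mul (_ : ℕ) (_ : ZMod q), ZMod.natCast_zmod_val]
    rw [hf]
    exact sum_mem fun a _ => sum_mem fun b _ =>
      nsmul_mem (AddSubgroup.subset_closure (Set.mem_ofPred.2 ⟨a, j, b, j, rfl⟩)) _

end Voltage

theorem exists_isHomogeneousVoltage (J : Type) [Finite J] [Nontrivial J] (n : ℕ) :
    ∃ (X : Type) (_ : AddCommGroup X) (_ : Finite X) (s : J → J → X),
      IsHomogeneousVoltage s ∧ n + 2 ≤ Nat.card X := by
  classical
  have := Fintype.ofFinite J
  -- This modulus makes `n + 1` a solution `t` of `1 + |J| t = 0`.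
  set q := Fintype.card J * (n + 1) + 1 with hq
  have ht : 1 + Fintype.card J * ((n + 1 : ℕ) : ZMod q) = 0 := by
    have := ZMod.natCast_self q
    rw [add_comm]
    exact_mod_cast this
  refine ⟨zeroSum J (ZMod q), inferInstance, inferInstance, tensorVoltage ht,
    isHomogeneousVoltage_tensorVoltage ht, ?_⟩
  -- For `a ≠ b` the alternating element has `(a, a)` entry 1, so its multiples embed `ZMod q`.
  obtain ⟨a, b, hab⟩ := exists_pair_ne J
  have hinj : Function.Injective fun r : ZMod q => r.val • (tensorVoltage ht a a -
      tensorVoltage ht b a + tensorVoltage ht b b - tensorVoltage ht a b) := by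
    intro r r' h
    have h' := congrFun (congrFun (congrArg Subtype.val h) a) a
    simp only [AddSubgroup.coe_nsmul, Pi.smul_apply, tensorVoltage_alternating] at h'
    simpa [hab] using h'
  have hcard := Nat.card_le_card_of_injective _ hinj
  rw [Nat.card_zmod] at hcard
  have := Fintype.card_pos (α := J)
  nlinarith


section Construction

variable {Ω J X : Type*} [AddCommGroup X]

/-! ### The blow-up graph and its connectedness. -/

/-- The bipartite graph with parts `X × Ω` in which `(x, ω)` in the first part is adjacent to
`(x + s (π ω) (π ω'), ω')` in the second part. Each neighbourhood is parametrised by `Ω`. -/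
def blowup (π : Ω → J) (s : J → J → X) : SimpleGraph (X × Ω × Bool) where
  Adj v w := (v.2.2 = false ∧ w.2.2 = true ∧ w.1 = v.1 + s (π v.2.1) (π w.2.1)) ∨
    (v.2.2 = true ∧ w.2.2 = false ∧ v.1 = w.1 + s (π w.2.1) (π v.2.1))
  symm := ⟨fun _ _ h => h.elim (fun h => .inr ⟨h.2.1, h.1, h.2.2⟩)
    fun h => .inl ⟨h.2.1, h.1, h.2.2⟩⟩
  loopless := ⟨fun _ h => by
    rcases h with ⟨h, h', -⟩ | ⟨h, h', -⟩ <;> simp [h] at h'⟩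

variable {π : Ω → J} {s : J → J → X}

theorem blowup_adj_false_true {x y : X} {ω ω' : Ω} :
    (blowup π s).Adj (x, ω, false) (y, ω', true) ↔ y = x + s (π ω) (π ω') := by
  simp [blowup]

theorem blowup_adj_true_false {x y : X} {ω ω' : Ω} :
    (blowup π s).Adj (x, ω, true) (y, ω', false) ↔ x = y + s (π ω') (π ω) := by
  simp [blowup]

theorem blowup_not_adj {x y : X} {ω ω' : Ω} {ε : Bool} :
    ¬ (blowup π s).Adj (x, ω, ε) (y, ω', ε) := by
  cases ε <;> simp [blowup]

theorem exists_blowup_adj (v : X × Ω × Bool) (ω : Ω) : ∃ x ε, (blowup π s).Adj v (x, ω, ε) := by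
  obtain ⟨x, ω', _ | _⟩ := v
  · exact ⟨_, true, blowup_adj_false_true.2 rfl⟩
  · exact ⟨x - s (π ω) (π ω'), false, blowup_adj_true_false.2 (by simp)⟩

theorem blowup_adj_unique {v w w' : X × Ω × Bool} (hw : (blowup π s).Adj v w)
    (hw' : (blowup π s).Adj v w') (h : w.2.1 = w'.2.1) : w = w' := by
  obtain ⟨x, ω, _ | _⟩ := v <;> obtain ⟨y, ω', _ | _⟩ := w <;>
    obtain ⟨y', ω'', _ | _⟩ := w' <;> obtain rfl : ω' = ω'' := h <;>
    simp_all [blowup]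

/-- The neighbourhood of a vertex is in bijection with `Ω`. -/
noncomputable def blowupNeighborEquiv (π : Ω → J) (s : J → J → X) (v : X × Ω × Bool) :
    (blowup π s).neighborSet v ≃ Ω :=
  Equiv.ofBijective (fun w => w.1.2.1)
    ⟨fun w w' h => Subtype.ext (blowup_adj_unique w.2 w'.2 h), fun ω => by
      obtain ⟨x, ε, h⟩ := exists_blowup_adj (π := π) (s := s) v ω
      exact ⟨⟨_, h⟩, rfl⟩⟩

@[simp]
theorem blowupNeighborEquiv_apply (v : X × Ω × Bool) (w : (blowup π s).neighborSet v) :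
    blowupNeighborEquiv π s v w = w.1.2.1 := rfl

theorem blowup_connected [Nonempty Ω] (hπ : Function.Surjective π)
    (hs : AddSubgroup.closure
      {x | ∃ a a' b b', x = s a b - s a' b + s a' b' - s a b'} = ⊤) :
    (blowup π s).Connected := by
  obtain ⟨ω₀⟩ := ‹Nonempty Ω›
  have two_step (x : X) (ω ω' : Ω) (b : J) : (blowup π s).Reachable (x, ω, false)
      (x + s (π ω) b - s (π ω') b, ω', false) := by
    obtain ⟨β, rfl⟩ := hπ b
    refine SimpleGraph.Reachable.trans
      (SimpleGraph.Adj.reachable (blowup_adj_false_true (ω' := β).2 rfl))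
      (SimpleGraph.Adj.reachable (blowup_adj_true_false.2 (by abel)))
  have translate (x g : X) (ω : Ω) : (blowup π s).Reachable (x, ω, false) (x + g, ω, false) := by
    have hg : g ∈ AddSubgroup.closure
        {x | ∃ a a' b b', x = s a b - s a' b + s a' b' - s a b'} := hs ▸ AddSubgroup.mem_top g
    induction hg using AddSubgroup.closure_induction generalizing x with
    | mem g hg =>
      obtain ⟨a, a', b, b', rfl⟩ := hg
      obtain ⟨α, rfl⟩ := hπ a
      obtain ⟨α', rfl⟩ := hπ a'
      -- A walk from the fibre of `ω` to that of `α`, around a 4-cycle of the base graph, and back;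
      -- the outer legs cancel.
      have h := (two_step x ω α b).trans <| (two_step _ α α' b).trans <|
        (two_step _ α' α b').trans <| two_step _ α ω b
      convert h using 2
      abel
    | zero => simp
    | add g g' _ _ hg hg' =>
      rw [← add_assoc]
      exact (hg x).trans (hg' _)
    | neg g _ hg =>
      have h := (hg (x + -g)).symm
      rwa [neg_add_cancel_right] at h
  have from_base (v : X × Ω × Bool) : (blowup π s).Reachable (0, ω₀, false) v := by
    have even (x : X) (ω : Ω) : (blowup π s).Reachable (0, ω₀, false) (x, ω, false) := by
      have h := (two_step 0 ω₀ ω (π ω)).trans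
        (translate _ (x - (0 + s (π ω₀) (π ω) - s (π ω) (π ω))) ω)
      rwa [add_sub_cancel] at h
    obtain ⟨x, ω, _ | _⟩ := v
    · exact even x ω
    · exact (even (x - s (π ω) (π ω)) ω).trans
        (SimpleGraph.Adj.reachable (blowup_adj_false_true.2 (by simp)))
  exact (SimpleGraph.connected_iff_exists_forall_reachable _).2 ⟨_, from_base⟩

/-! ### The locally-`L` group: transitivity and local action. -/

/-- The automorphisms of the blow-up that induce an element of `L` on each neighbourhood. -/
def blowupGroup (L : Subgroup (Equiv.Perm Ω)) (π : Ω → J) (s : J → J → X) :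
    Subgroup (blowup π s ≃g blowup π s) where
  carrier := {g | ∀ v, ∃ l ∈ L, ∀ w, (blowup π s).Adj v w → (g w).2.1 = l w.2.1}
  one_mem' v := ⟨1, L.one_mem, fun _ _ => rfl⟩
  mul_mem' := by
    intro g h hg hh v
    obtain ⟨l, hl, hlh⟩ := hh v
    obtain ⟨l', hl', hlg⟩ := hg (h v)
    refine ⟨l' * l, L.mul_mem hl' hl, fun w hw => ?_⟩
    rw [RelIso.mul_apply, hlg _ (h.map_rel_iff.2 hw), hlh w hw, Equiv.Perm.mul_apply]
  inv_mem' := by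
    intro g hg v
    obtain ⟨l, hl, hlg⟩ := hg (g⁻¹ v)
    refine ⟨l⁻¹, L.inv_mem hl, fun w hw => ?_⟩
    have h := hlg (g⁻¹ w) (g⁻¹.map_rel_iff.2 hw)
    rw [RelIso.apply_inv_self] at h
    rw [h]
    exact (l.symm_apply_apply _).symm

/-- The automorphism of the blow-up that acts on `X` by an affine map and on the two copies of `Ω`
by two permutations preserving the fibres of `π`. -/
def blowupAffine (σ : Bool → Equiv.Perm J) (l : Bool → Equiv.Perm Ω)
    (hl : ∀ ε ω, π (l ε ω) = σ ε (π ω)) (ρ : X ≃+ X)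
    (hρ : ∀ a b, ρ (s a b) = s (σ false a) (σ true b)) (x₀ : X) :
    blowup π s ≃g blowup π s where
  toFun v := (ρ v.1 + x₀, l v.2.2 v.2.1, v.2.2)
  invFun v := (ρ.symm (v.1 - x₀), (l v.2.2).symm v.2.1, v.2.2)
  left_inv v := by simp
  right_inv v := by simp
  map_rel_iff' := by
    have key (x y : X) (ω ω' : Ω) :
        ρ y + x₀ = ρ x + x₀ + s (π (l false ω)) (π (l true ω')) ↔ y = x + s (π ω) (π ω') := by
      rw [hl, hl, ← hρ, add_right_comm, add_left_inj, ← map_add, ρ.injective.eq_iff]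
    rintro ⟨x, ω, _ | _⟩ ⟨y, ω', _ | _⟩
    · exact iff_of_false blowup_not_adj blowup_not_adj
    · exact blowup_adj_false_true.trans ((key x y ω ω').trans blowup_adj_false_true.symm)
    · exact blowup_adj_true_false.trans ((key y x ω' ω).trans blowup_adj_true_false.symm)
    · exact iff_of_false blowup_not_adj blowup_not_adj

/-- The automorphism of the blow-up that exchanges the two parts. -/
def blowupSwap (τ : X ≃+ X) (hτ : ∀ a b, τ (s a b) = -s b a) : blowup π s ≃g blowup π s where
  toFun v := (τ v.1, v.2.1, !v.2.2)
  invFun v := (τ.symm v.1, v.2.1, !v.2.2)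
  left_inv v := by simp
  right_inv v := by simp
  map_rel_iff' := by
    have key (x y : X) (ω ω' : Ω) :
        τ x = τ y + s (π ω') (π ω) ↔ y = x + s (π ω) (π ω') := by
      rw [← τ.injective.eq_iff (a := y), map_add, hτ, ← sub_eq_add_neg, eq_sub_iff_add_eq, eq_comm]
    rintro ⟨x, ω, _ | _⟩ ⟨y, ω', _ | _⟩
    · exact iff_of_false blowup_not_adj blowup_not_adj
    · exact blowup_adj_true_false.trans ((key x y ω ω').trans blowup_adj_false_true.symm)
    · exact blowup_adj_false_true.trans ((key y x ω' ω).trans blowup_adj_true_false.symm)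
    · exact iff_of_false blowup_not_adj blowup_not_adj

variable {L : Subgroup (Equiv.Perm Ω)}

theorem blowupAffine_mem {σ : Bool → Equiv.Perm J} {l : Bool → Equiv.Perm Ω}
    {hl : ∀ ε ω, π (l ε ω) = σ ε (π ω)} {ρ : X ≃+ X}
    {hρ : ∀ a b, ρ (s a b) = s (σ false a) (σ true b)} {x₀ : X} (hL : ∀ ε, l ε ∈ L) :
    blowupAffine σ l hl ρ hρ x₀ ∈ blowupGroup L π s := by
  rintro ⟨x, ω, ε⟩
  refine ⟨l !ε, hL _, ?_⟩
  rintro ⟨y, ω', ε'⟩ h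
  obtain rfl : ε' = !ε := by
    by_contra hε
    obtain rfl : ε' = ε := by cases ε <;> cases ε' <;> simp_all
    exact blowup_not_adj h
  rfl

theorem blowupSwap_mem {τ : X ≃+ X} {hτ : ∀ a b, τ (s a b) = -s b a} :
    blowupSwap τ hτ ∈ blowupGroup L π s :=
  fun _ => ⟨1, L.one_mem, fun _ _ => rfl⟩

theorem exists_mem_blowupGroup (hs : IsHomogeneousVoltage s)
    (hπ : ∀ l ∈ L, ∃ σ : Equiv.Perm J, ∀ ω, π (l ω) = σ (π ω)) {l : Bool → Equiv.Perm Ω}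
    (hl : ∀ ε, l ε ∈ L) (x y : X) :
    ∃ g ∈ blowupGroup L π s, (∀ z ω ε, (g (z, ω, ε)).2 = (l ε ω, ε)) ∧
      ∀ ω ε, (g (x, ω, ε)).1 = y := by
  choose σ hσ using fun ε => hπ (l ε) (hl ε)
  obtain ⟨ρ, hρ⟩ := hs.lift_perm (σ false) (σ true)
  exact ⟨blowupAffine σ l hσ ρ hρ (y - ρ x), blowupAffine_mem hl, fun _ _ _ => rfl,
    fun _ _ => add_sub_cancel _ _⟩

theorem blowupGroup_isPretransitive (hs : IsHomogeneousVoltage s)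
    (hπ : ∀ l ∈ L, ∃ σ : Equiv.Perm J, ∀ ω, π (l ω) = σ (π ω))
    (hL : ∀ ω ω' : Ω, ∃ l ∈ L, l ω = ω') :
    MulAction.IsPretransitive (blowupGroup L π s) (X × Ω × Bool) := by
  have same_part (x y : X) (ω ω' : Ω) (ε : Bool) :
      ∃ g ∈ blowupGroup L π s, g (x, ω, ε) = (y, ω', ε) := by
    obtain ⟨l, hl, rfl⟩ := hL ω ω'
    obtain ⟨g, hg, h, h'⟩ := exists_mem_blowupGroup (s := s) hs hπ (l := fun _ => l)
      (fun _ => hl) x y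
    exact ⟨g, hg, Prod.ext (h' _ _) (h _ _ _)⟩
  refine ⟨fun ⟨x, ω, ε⟩ ⟨y, ω', ε'⟩ => ?_⟩
  obtain rfl | rfl : ε' = ε ∨ ε' = !ε := by cases ε <;> cases ε' <;> simp
  · obtain ⟨g, hg, h⟩ := same_part x y ω ω' ε'
    exact ⟨⟨g, hg⟩, h⟩
  · obtain ⟨τ, hτ⟩ := hs.lift_swap
    obtain ⟨g, hg, h⟩ := same_part (τ x) y ω ω' !ε
    exact ⟨⟨g, hg⟩ * ⟨blowupSwap τ hτ, blowupSwap_mem⟩, h⟩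

theorem permIsomorphic_localAction_blowupGroup (hs : IsHomogeneousVoltage s)
    (hπ : ∀ l ∈ L, ∃ σ : Equiv.Perm J, ∀ ω, π (l ω) = σ (π ω)) (v : X × Ω × Bool) :
    PermIsomorphic (localAction (blowupGroup L π s) v) L := by
  refine ⟨blowupNeighborEquiv π s v, le_antisymm ?_ fun l hl => ?_⟩
  · rintro _ ⟨τ, ⟨g, hg, hgv, hτ⟩, rfl⟩
    obtain ⟨l, hl, hlg⟩ := hg v
    convert hl
    ext ω
    obtain ⟨w, rfl⟩ := (blowupNeighborEquiv π s v).surjective ω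
    rw [blowupNeighborEquiv_apply, ← hlg w.1 w.2, ← hτ, ← blowupNeighborEquiv_apply]
    exact congrArg (fun w => blowupNeighborEquiv π s v (τ w)) (Equiv.symm_apply_apply _ w)
  · obtain ⟨x, ω, ε⟩ := v
    -- Acting trivially on the labels in the part of `v` fixes `v`, while `l` acts on the labels in
    -- the opposite part, which contains the neighbours.
    obtain ⟨g, hg, h, h'⟩ := exists_mem_blowupGroup (s := s) hs hπ
      (l := fun ε' => if ε' = ε then 1 else l)
      (fun ε' => by split_ifs; exacts [L.one_mem, hl]) x x
    have hgv : g (x, ω, ε) = (x, ω, ε) := Prod.ext (h' _ _) (by simp [h])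
    refine ⟨(blowupNeighborEquiv π s (x, ω, ε)).symm.permCongr l, ⟨g, hg, hgv, fun w => ?_⟩, ?_⟩
    · have hadj : (blowup π s).Adj (x, ω, ε) (g w) := by
        have := g.map_rel_iff.2 w.2
        rwa [hgv] at this
      refine blowup_adj_unique (Subtype.prop _) hadj ?_
      rw [← blowupNeighborEquiv_apply]
      obtain ⟨⟨y, ω', ε'⟩, hw⟩ := w
      have hε : ε' ≠ ε := by
        rintro rfl
        exact blowup_not_adj hw
      simp [Equiv.permCongr_apply, h, hε]
    · ext
      simp [Equiv.permCongrHom]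

theorem isLocallyPair_blowupGroup [Finite X] [Finite Ω] [Nonempty Ω]
    (hs : IsHomogeneousVoltage s) (hsurj : Function.Surjective π)
    (hπ : ∀ l ∈ L, ∃ σ : Equiv.Perm J, ∀ ω, π (l ω) = σ (π ω))
    (hL : ∀ ω ω' : Ω, ∃ l ∈ L, l ω = ω') :
    IsLocallyPair L (blowup π s) (blowupGroup L π s) where
  finite := inferInstance
  connected := blowup_connected hsurj hs.generates
  vertexTransitive := blowupGroup_isPretransitive hs hπ hL
  local_iso := permIsomorphic_localAction_blowupGroup hs hπ

/-! ### Independent action on fibres and the size of stabilisers. -/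

/-- The elements of `L` that fix every point outside the fibre of `π` over `j`. -/
def fiberFixer (L : Subgroup (Equiv.Perm Ω)) (π : Ω → J) (j : J) : Subgroup (Equiv.Perm Ω) where
  carrier := {l | l ∈ L ∧ ∀ ω, π ω ≠ j → l ω = ω}
  one_mem' := ⟨L.one_mem, fun _ _ => rfl⟩
  mul_mem' := by
    rintro l l' ⟨hl, h⟩ ⟨hl', h'⟩
    exact ⟨L.mul_mem hl hl', fun ω hω => by rw [Equiv.Perm.mul_apply, h' ω hω, h ω hω]⟩
  inv_mem' := by
    rintro l ⟨hl, h⟩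
    exact ⟨L.inv_mem hl, fun ω hω => by rw [Equiv.Perm.inv_eq_iff_eq, h ω hω]⟩

theorem apply_fiberFixer {j : J} {l : Equiv.Perm Ω} (hl : l ∈ fiberFixer L π j) (ω : Ω) :
    π (l ω) = π ω := by
  by_cases hω : π ω = j
  · by_contra h
    have := hl.2 (l ω) (hω ▸ h)
    exact h (congrArg π (l.injective this))
  · rw [hl.2 ω hω]

/-- The `d j` have disjoint supports, so their product acts on each fibre as its own factor. -/
theorem exists_mem_forall_apply_eq [Finite J] {d : J → Equiv.Perm Ω}
    (hd : ∀ j, d j ∈ fiberFixer L π j) : ∃ l ∈ L, ∀ ω, l ω = d (π ω) ω := by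
  classical
  have := Fintype.ofFinite J
  have partial_glue (S : Finset J) : ∃ l ∈ L, ∀ ω, l ω = if π ω ∈ S then d (π ω) ω else ω := by
    induction S using Finset.induction_on with
    | empty => exact ⟨1, L.one_mem, by simp⟩
    | insert j S hj ih =>
      obtain ⟨l, hl, h⟩ := ih
      refine ⟨d j * l, L.mul_mem (hd j).1 hl, fun ω => ?_⟩
      rw [Equiv.Perm.mul_apply, h]
      by_cases hω : π ω = j
      · simp [hω, hj]
      · have hω' : π (d (π ω) ω) ≠ j := by rwa [apply_fiberFixer (hd _)]
        by_cases hS : π ω ∈ S <;> simp [hS, hω, (hd j).2 _ hω, (hd j).2 _ hω']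
  obtain ⟨l, hl, h⟩ := partial_glue Finset.univ
  exact ⟨l, hl, by simpa using h⟩

/-- The automorphism of the blow-up acting independently on the fibres over `X × J × Bool`. -/
def blowupFiberwise (s : J → J → X) (c : X × J × Bool → Equiv.Perm Ω)
    (hc : ∀ u, c u ∈ fiberFixer L π u.2.1) : blowup π s ≃g blowup π s where
  toFun v := (v.1, c (v.1, π v.2.1, v.2.2) v.2.1, v.2.2)
  invFun v := (v.1, (c (v.1, π v.2.1, v.2.2)).symm v.2.1, v.2.2)
  left_inv v := by simp [apply_fiberFixer (hc _)]
  right_inv v := by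
    have h (u) (ω) : π ((c u).symm ω) = π ω := apply_fiberFixer (inv_mem (hc u)) ω
    simp [h]
  map_rel_iff' := by
    intro v w
    simp [blowup, apply_fiberFixer (hc _)]

/-- The neighbours of a vertex with labels over `j` share one `X`-coordinate, so only one value of
`c` per block is seen, and these values glue to an element of `L`. -/
theorem blowupFiberwise_mem [Finite J] {c : X × J × Bool → Equiv.Perm Ω}
    {hc : ∀ u, c u ∈ fiberFixer L π u.2.1} : blowupFiberwise s c hc ∈ blowupGroup L π s := by
  rintro ⟨x, ω, _ | _⟩
  · obtain ⟨l, hl, h⟩ := exists_mem_forall_apply_eq (L := L) (π := π)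
      (d := fun j => c (x + s (π ω) j, j, true)) fun j => hc _
    refine ⟨l, hl, ?_⟩
    rintro ⟨y, ω', _ | _⟩ hw
    · exact (blowup_not_adj hw).elim
    · obtain rfl := blowup_adj_false_true.1 hw
      exact (h ω').symm
  · obtain ⟨l, hl, h⟩ := exists_mem_forall_apply_eq (L := L) (π := π)
      (d := fun j => c (x - s j (π ω), j, false)) fun j => hc _
    refine ⟨l, hl, ?_⟩
    rintro ⟨y, ω', _ | _⟩ hw
    · obtain rfl := eq_sub_iff_add_eq.2 (blowup_adj_true_false.1 hw).symm
      exact (h ω').symm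
    · exact (blowup_not_adj hw).elim

theorem blowupFiberwise_injective {c c' : X × J × Bool → Equiv.Perm Ω}
    {hc : ∀ u, c u ∈ fiberFixer L π u.2.1} {hc' : ∀ u, c' u ∈ fiberFixer L π u.2.1}
    (h : blowupFiberwise s c hc = blowupFiberwise s c' hc') : c = c' := by
  funext u
  ext ω
  obtain ⟨x, j, ε⟩ := u
  by_cases hω : π ω = j
  · subst hω
    exact congrArg (fun v => v.2.1) (DFunLike.congr_fun h (x, ω, ε))
  · rw [(hc _).2 ω hω, (hc' _).2 ω hω]

theorem exists_mem_forall_apply_eq_iff (hsurj : Function.Surjective π)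
    (hπ : ∀ l ∈ L, ∃ σ : Equiv.Perm J, ∀ ω, π (l ω) = σ (π ω))
    (hL : ∀ ω ω' : Ω, ∃ l ∈ L, l ω = ω') (i j : J) :
    ∃ l ∈ L, ∀ ω, π (l ω) = j ↔ π ω = i := by
  obtain ⟨ω, rfl⟩ := hsurj i
  obtain ⟨ω', rfl⟩ := hsurj j
  obtain ⟨l, hl, rfl⟩ := hL ω ω'
  obtain ⟨σ, hσ⟩ := hπ l hl
  exact ⟨l, hl, fun ω => by rw [hσ, hσ, σ.injective.eq_iff]⟩

theorem conj_mem_fiberFixer {i j : J} {t l : Equiv.Perm Ω} (ht : t ∈ L)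
    (htij : ∀ ω, π (t ω) = j ↔ π ω = i) (hl : l ∈ fiberFixer L π i) :
    t * l * t⁻¹ ∈ fiberFixer L π j := by
  refine ⟨L.mul_mem (L.mul_mem ht hl.1) (L.inv_mem ht), fun ω hω => ?_⟩
  have h : π (t⁻¹ ω) ≠ i := by rwa [Ne, ← htij, show t (t⁻¹ ω) = ω from t.apply_symm_apply ω]
  rw [Equiv.Perm.mul_apply, Equiv.Perm.mul_apply, hl.2 _ h]
  exact t.apply_symm_apply ω

theorem pow_le_card_stabilizer_blowupGroup [Finite X] [Finite J] [Finite Ω]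
    (hsurj : Function.Surjective π)
    (hπ : ∀ l ∈ L, ∃ σ : Equiv.Perm J, ∀ ω, π (l ω) = σ (π ω))
    (hL : ∀ ω ω' : Ω, ∃ l ∈ L, l ω = ω') (j : J) (v : X × Ω × Bool) :
    Nat.card (fiberFixer L π j) ^ (Nat.card (X × J × Bool) - 1) ≤
      Nat.card (MulAction.stabilizer (blowupGroup L π s) v) := by
  classical
  choose t ht htj using exists_mem_forall_apply_eq_iff hsurj hπ hL j
  -- The fibre of `v` gets the identity so that `v` is fixed; this costs the 1 in the exponent.
  let u₀ : X × J × Bool := (v.1, π v.2.1, v.2.2)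
  let κ (f : {u // u ≠ u₀} → fiberFixer L π j) (u : X × J × Bool) : fiberFixer L π j :=
    (Equiv.funSplitAt u₀ _).symm (1, f) u
  let c (f : {u // u ≠ u₀} → fiberFixer L π j) (u : X × J × Bool) : Equiv.Perm Ω :=
    t u.2.1 * κ f u * (t u.2.1)⁻¹
  have hc (f) (u) : c f u ∈ fiberFixer L π u.2.1 :=
    conj_mem_fiberFixer (ht _) (htj _) (κ f u).2
  have hc₀ (f) : c f u₀ = 1 := by simp [c, κ, Equiv.funSplitAt, Equiv.piSplitAt]
  have hfix (f) : blowupFiberwise s (c f) (hc f) v = v :=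
    Prod.ext rfl (Prod.ext (by
      change c f u₀ v.2.1 = _
      rw [hc₀, Equiv.Perm.one_apply]) rfl)
  let F (f : {u // u ≠ u₀} → fiberFixer L π j) :
      MulAction.stabilizer (blowupGroup L π s) v :=
    ⟨⟨blowupFiberwise s (c f) (hc f), blowupFiberwise_mem⟩, hfix f⟩
  have hF : Function.Injective F := by
    intro f f' h
    have hcc : c f = c f' := blowupFiberwise_injective
      (hc := hc f) (hc' := hc f') (congrArg (fun g => g.1.1) h)
    have hκ : κ f = κ f' := by
      funext u
      have := congrFun hcc u
      simpa [c] using this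
    exact congrArg Prod.snd ((Equiv.funSplitAt u₀ _).symm.injective hκ)
  have : Finite (blowup π s ≃g blowup π s) := DFunLike.finite _
  refine le_trans (le_of_eq ?_) (Nat.card_le_card_of_injective F hF)
  have := Fintype.ofFinite (X × J × Bool)
  rw [Nat.card_fun, Nat.card_eq_fintype_card (α := {u // u ≠ u₀}),
    Nat.card_eq_fintype_card (α := X × J × Bool), Fintype.card_subtype_compl,
    Fintype.card_subtype_eq]

theorem card_eq_card_mul_card_fiber [Finite Ω] [Finite J] (hsurj : Function.Surjective π)
    (hπ : ∀ l ∈ L, ∃ σ : Equiv.Perm J, ∀ ω, π (l ω) = σ (π ω))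
    (hL : ∀ ω ω' : Ω, ∃ l ∈ L, l ω = ω') (j : J) :
    Nat.card Ω = Nat.card J * Nat.card {ω // π ω = j} := by
  choose t _ htj using exists_mem_forall_apply_eq_iff hsurj hπ hL j
  rw [← Nat.card_prod]
  exact Nat.card_congr <| (Equiv.sigmaFiberEquiv π).symm.trans <|
    (Equiv.sigmaCongrRight fun i => ((t i).subtypeEquiv fun ω => (htj i ω).symm).symm).trans <|
    Equiv.sigmaEquivProd _ _

end Construction

/-! ### Assembling the pairs; transport of structure and blocks. -/

theorem exists_isLocallyPair_le_card_stabilizer {Ω J : Type} [Finite Ω] [Finite J] [Nontrivial J]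
    {L : Subgroup (Equiv.Perm Ω)} {π : Ω → J} (hsurj : Function.Surjective π)
    (hπ : ∀ l ∈ L, ∃ σ : Equiv.Perm J, ∀ ω, π (l ω) = σ (π ω))
    (hL : ∀ ω ω' : Ω, ∃ l ∈ L, l ω = ω') (j : J) (n : ℕ) :
    ∃ (V : Type) (Λ : SimpleGraph V) (H : Subgroup (Λ ≃g Λ)), IsLocallyPair L Λ H ∧
      n ≤ Nat.card V ∧ 2 * Nat.card {ω // π ω = j} ≤ Nat.card V ∧
      ∀ v : V, (Nat.card (fiberFixer L π j) : ℝ) ^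
        ((Nat.card V : ℝ) / Nat.card {ω // π ω = j} - 1) ≤
          Nat.card (MulAction.stabilizer H v) := by
  obtain ⟨X, _, _, s, hs, hX⟩ := exists_isHomogeneousVoltage J n
  have : Nonempty Ω := (hsurj j).nonempty
  obtain ⟨ω, hω⟩ := hsurj j
  have hk : 0 < Nat.card {ω // π ω = j} :=
    have : Nonempty {ω // π ω = j} := ⟨ω, hω⟩
    Nat.card_pos
  have hV : Nat.card (X × Ω × Bool) =
      Nat.card (X × J × Bool) * Nat.card {ω // π ω = j} := by
    simp only [Nat.card_prod, card_eq_card_mul_card_fiber hsurj hπ hL j]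
    ring
  -- The summand 2 provides the bound `2k ≤ |V|` needed for exponential growth.
  have hN : n + 2 ≤ Nat.card (X × J × Bool) := by
    rw [Nat.card_prod]
    exact hX.trans (Nat.le_mul_of_pos_right _ Nat.card_pos)
  refine ⟨X × Ω × Bool, blowup π s, blowupGroup L π s,
    isLocallyPair_blowupGroup hs hsurj hπ hL, ?_, ?_, fun v => ?_⟩
  · rw [hV]
    nlinarith
  · rw [hV]
    exact Nat.mul_le_mul_right _ (by omega)
  · have h := pow_le_card_stabilizer_blowupGroup (s := s) hsurj hπ hL j v
    have hexp : (Nat.card (X × Ω × Bool) : ℝ) / Nat.card {ω // π ω = j} - 1 =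
        (Nat.card (X × J × Bool) - 1 : ℕ) := by
      rw [hV, Nat.cast_mul, mul_div_cancel_right₀ _ (by positivity), Nat.cast_sub (by omega),
        Nat.cast_one]
    rw [hexp, Real.rpow_natCast]
    exact_mod_cast h


theorem PermIsomorphic.trans {Ω Δ Θ : Type*} {L : Subgroup (Equiv.Perm Ω)}
    {M : Subgroup (Equiv.Perm Δ)} {N : Subgroup (Equiv.Perm Θ)} (h : PermIsomorphic L M)
    (h' : PermIsomorphic M N) : PermIsomorphic L N := by
  obtain ⟨e, rfl⟩ := h
  obtain ⟨f, rfl⟩ := h'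
  exact ⟨e.trans f, by rw [Subgroup.map_map]; rfl⟩

theorem PermIsomorphic.symm {Ω Δ : Type*} {L : Subgroup (Equiv.Perm Ω)}
    {M : Subgroup (Equiv.Perm Δ)} (h : PermIsomorphic L M) : PermIsomorphic M L := by
  obtain ⟨e, rfl⟩ := h
  refine ⟨e.symm, ?_⟩
  rw [Subgroup.map_map]
  convert L.map_id
  ext l ω
  simp [Equiv.permCongrHom]

theorem IsLocallyPair.of_permIsomorphic {Ω Δ V : Type*} {L : Subgroup (Equiv.Perm Ω)}
    {M : Subgroup (Equiv.Perm Δ)} {Γ : SimpleGraph V} {G : Subgroup (Γ ≃g Γ)}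
    (h : IsLocallyPair L Γ G) (hLM : PermIsomorphic L M) : IsLocallyPair M Γ G :=
  ⟨h.finite, h.connected, h.vertexTransitive, fun v => (h.local_iso v).trans hLM⟩

/-- A nonempty block is a fibre of an equivariant map. -/
theorem exists_fiber_eq_of_isBlock {Ω : Type*} [Finite Ω] {L : Subgroup (Equiv.Perm Ω)}
    {B : Set Ω} (hB : MulAction.IsBlock L B) (hne : B.Nonempty) :
    ∃ (m : ℕ) (π : Ω → Fin m) (j : Fin m), Function.Surjective π ∧
      (∀ l ∈ L, ∃ σ : Equiv.Perm (Fin m), ∀ ω, π (l ω) = σ (π ω)) ∧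
      ∀ ω, π ω = j ↔ ω ∈ B := by
  -- Points are identified when no translate of `B` separates them; the block property makes `B`
  -- itself a class.
  let r : Setoid Ω :=
    { r := fun ω ω' => ∀ l ∈ L, l ω ∈ B ↔ l ω' ∈ B
      iseqv := ⟨fun _ _ _ => Iff.rfl, fun h l hl => (h l hl).symm,
        fun h h' l hl => (h l hl).trans (h' l hl)⟩ }
  obtain ⟨m, ⟨e⟩⟩ := Finite.exists_equiv_fin (Quotient r)
  obtain ⟨b, hb⟩ := hne
  have hr (l) (hl : l ∈ L) (ω ω' : Ω) : r ω ω' ↔ r (l ω) (l ω') := by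
    refine ⟨fun h l' hl' => h (l' * l) (L.mul_mem hl' hl), fun h l' hl' => ?_⟩
    simpa using h (l' * l⁻¹) (L.mul_mem hl' (L.inv_mem hl))
  refine ⟨m, fun ω => e ⟦ω⟧, e ⟦b⟧, e.surjective.comp Quotient.mk_surjective, fun l hl => ?_,
    fun ω => ?_⟩
  · exact ⟨e.permCongr (Quotient.congr l (hr l hl)), fun ω => by
      simp [Equiv.permCongr_apply]⟩
  · rw [e.injective.eq_iff, Quotient.eq]
    refine ⟨fun h => (h 1 L.one_mem).2 hb, fun hω l hl => ?_⟩
    have hiff (c : Ω) (hc : c ∈ B) (c' : Ω) (hc' : c' ∈ B) (h : l c ∈ B) : l c' ∈ B := by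
      have hsmul := hB.smul_eq_of_mem (g := ⟨l, hl⟩) hc h
      rw [← hsmul]
      exact Set.smul_mem_smul_set (a := (⟨l, hl⟩ : L)) hc'
    exact ⟨hiff ω hω b hb, hiff b hb ω hω⟩

theorem card_fiberFixer_map {Ω Δ J : Type*} {L : Subgroup (Equiv.Perm Ω)} {B : Set Ω} {π : Ω → J}
    {j : J} (hπB : ∀ ω, π ω = j ↔ ω ∈ B) (e : Ω ≃ Δ) :
    Nat.card (fiberFixer (L.map e.permCongrHom.toMonoidHom) (π ∘ e.symm) j) =
      Nat.card (fixingSubgroup L Bᶜ) := by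
  symm
  refine Nat.card_congr <| Equiv.ofBijective (fun l => ⟨e.permCongrHom l.1.1,
    ⟨l.1.1, l.1.2, rfl⟩, fun δ hδ => ?_⟩) ⟨fun l l' h => ?_, ?_⟩
  · have h := (mem_fixingSubgroup_iff L).1 l.2 (e.symm δ) fun h => hδ ((hπB _).2 h)
    exact (congrArg e h).trans (e.apply_symm_apply δ)
  · exact Subtype.ext (Subtype.ext (e.permCongrHom.injective (congrArg Subtype.val h)))
  · rintro ⟨_, ⟨l, hl, rfl⟩, h⟩
    refine ⟨⟨⟨l, hl⟩, (mem_fixingSubgroup_iff L).2 fun ω hω => ?_⟩, rfl⟩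
    have := h (e ω) (by simpa [hπB] using hω)
    simpa [Equiv.permCongrHom, Subgroup.smul_def] using this

theorem exists_isLocallyPair_of_isBlock {Ω : Type*} [Finite Ω] {L : Subgroup (Equiv.Perm Ω)}
    (hL : MulAction.IsPretransitive L Ω) {B : Set Ω} (hB : MulAction.IsBlock L B)
    (hne : B.Nonempty) (huniv : B ≠ Set.univ) (n : ℕ) :
    ∃ (V : Type) (Λ : SimpleGraph V) (H : Subgroup (Λ ≃g Λ)), IsLocallyPair L Λ H ∧
      n ≤ Nat.card V ∧ 2 * B.ncard ≤ Nat.card V ∧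
      ∀ v : V, (Nat.card (fixingSubgroup L Bᶜ) : ℝ) ^ ((Nat.card V : ℝ) / B.ncard - 1) ≤
        Nat.card (MulAction.stabilizer H v) := by
  obtain ⟨m, π, j, hsurj, hπ, hπB⟩ := exists_fiber_eq_of_isBlock hB hne
  -- `Ω` may lie in any universe, whereas the vertex types must lie in `Type`.
  obtain ⟨d, ⟨e⟩⟩ := Finite.exists_equiv_fin Ω
  have : Nontrivial (Fin m) := by
    obtain ⟨ω, hω⟩ := (Set.ne_univ_iff_exists_notMem B).1 huniv
    exact ⟨π ω, j, fun h => hω ((hπB ω).1 h)⟩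
  have hcard : Nat.card {i // (π ∘ e.symm) i = j} = B.ncard :=
    Nat.card_congr (e.symm.subtypeEquiv fun i => hπB (e.symm i))
  obtain ⟨V, Λ, H, hΛ, hV⟩ := exists_isLocallyPair_le_card_stabilizer
    (L := L.map e.permCongrHom.toMonoidHom) (hsurj.comp e.symm.surjective) (by
      rintro _ ⟨l, hl, rfl⟩
      obtain ⟨σ, hσ⟩ := hπ l hl
      exact ⟨σ, fun i => by simp [Equiv.permCongrHom, hσ]⟩) (fun i i' => by
      obtain ⟨l, hl⟩ := hL.exists_smul_eq (e.symm i) (e.symm i')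
      exact ⟨_, ⟨l.1, l.2, rfl⟩, (congrArg e hl).trans (e.apply_symm_apply i')⟩) j n
  rw [hcard, card_fiberFixer_map hπB e] at hV
  exact ⟨V, Λ, H, hΛ.of_permIsomorphic (PermIsomorphic.symm ⟨e, rfl⟩), hV⟩

end GraphGrowth

theorem theorem1p2 {Ω : Type*} [Finite Ω] (L : Subgroup (Equiv.Perm Ω))
    (hL : MulAction.IsPretransitive L Ω) (B : Set Ω) (hB : MulAction.IsBlock L B)
    (hB' : ¬ MulAction.IsTrivialBlock B) (hfix : fixingSubgroup L (Bᶜ) ≠ ⊥) :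
    GraphGrowth.HasExponentialGraphGrowth L ∧
    ∃ (V : ℕ → Type) (Λ : (n : ℕ) → SimpleGraph (V n)) (H : (n : ℕ) → Subgroup (Λ n ≃g Λ n)),
      (∀ n, GraphGrowth.IsLocallyPair L (Λ n) (H n)) ∧
      Filter.Tendsto (fun n => Nat.card (V n)) Filter.atTop Filter.atTop ∧
      ∀ (n : ℕ) (v : V n),
        (Nat.card (fixingSubgroup L (Bᶜ)) : ℝ) ^ ((Nat.card (V n) : ℝ) / (B.ncard : ℝ) - 1) ≤
          (Nat.card (MulAction.stabilizer (H n) v) : ℝ) := by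
  obtain ⟨hsub, huniv⟩ := not_or.1 hB'
  have hne : B.Nonempty := (Set.not_subsingleton_iff.1 hsub).nonempty
  choose V Λ H hloc hcard htwo hstab using
    GraphGrowth.exists_isLocallyPair_of_isBlock hL hB hne huniv
  have htendsto : Filter.Tendsto (fun n => Nat.card (V n)) Filter.atTop Filter.atTop :=
    Filter.tendsto_atTop_mono hcard Filter.tendsto_id
  refine ⟨⟨V, Λ, H, hloc, htendsto, ?_⟩, V, Λ, H, hloc, htendsto, hstab⟩
  have hK : (1 : ℝ) < Nat.card (fixingSubgroup L Bᶜ) := by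
    exact_mod_cast (Subgroup.one_lt_card_iff_ne_bot _).2 hfix
  have hk : (0 : ℝ) < B.ncard := by
    exact_mod_cast (Set.ncard_pos).2 hne
  -- Since `|V| ≥ 2k`, we have `|V|/k - 1 ≥ |V|/(2k)`, which absorbs the loss of 1 in the exponent.
  refine ⟨(Nat.card (fixingSubgroup L Bᶜ) : ℝ) ^ (1 / (2 * B.ncard : ℝ)),
    Real.one_lt_rpow hK (by positivity), fun n v => le_trans ?_ (hstab n v)⟩
  rw [← Real.rpow_mul_natCast (by positivity)]
  refine Real.rpow_le_rpow_of_exponent_le hK.le ?_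
  have hV : (2 * B.ncard : ℝ) ≤ Nat.card (V n) := by exact_mod_cast htwo n
  have hdiv : 2 ≤ (Nat.card (V n) : ℝ) / B.ncard := by rwa [le_div_iff₀ hk]
  have hhalf : 1 / (2 * B.ncard : ℝ) * Nat.card (V n) = (Nat.card (V n) : ℝ) / B.ncard / 2 := by
    field_simp
  linarith
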